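/- Let $G$ be a finite connected subgraph of the grid graph $\mathbb Z^2$ that is symmetric about a diagonal $\ell$ of the grid (a line $x-y=c$ or $x+y=c$ with $c\in\mathbb Z$), and let $v$ be a vertex of $G$ that lies on $\ell$ and on the boundary of the unbounded face of $G$. Let $v_1,\dots,v_n$ be the vertices of $G$ on $\ell$ other than $v$. Select a spanning tree $T$ of $G$ uniformly at random and root it at $v$, that is, orient every edge of $T$ toward $v$, so that each vertex $u\neq v$ has exactly one outgoing edge, namely the first edge of the path of $T$ from $u$ to $v$. Let $Z_i$ be the random variable that takes the value $1$ if the outgoing edge of $v_i$ in $T$ is horizontal, and the value $0$ otherwise. Then $Z_1,\dots,Z_n$ are independent and identically distributed random variables with the Bernoulli distribution of parameter $1/2$. -/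

import Mathlib

open MeasureTheory ProbabilityTheory

noncomputable section

/-- The grid graph `ℤ²`: two lattice points are adjacent iff they are at distance one. -/
def gridGraph : SimpleGraph (ℤ × ℤ) where
  Adj p q := (p.2 = q.2 ∧ |p.1 - q.1| = 1) ∨ (p.1 = q.1 ∧ |p.2 - q.2| = 1)
  symm := ⟨by
    rintro p q (⟨h, h'⟩ | ⟨h, h'⟩)
    · exact Or.inl ⟨h.symm, by rwa [abs_sub_comm]⟩
    · exact Or.inr ⟨h.symm, by rwa [abs_sub_comm]⟩⟩
  loopless := ⟨by rintro p (⟨_, h⟩ | ⟨_, h⟩) <;> simp at h⟩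

/-- The diagonals of the grid: the lines `x - y = c` and the lines `x + y = c`, with `c ∈ ℤ`. -/
inductive GridDiagonal where
  | ascending (c : ℤ)
  | descending (c : ℤ)

namespace GridDiagonal

/-- The lattice points that lie on a diagonal. -/
def points : GridDiagonal → Set (ℤ × ℤ)
  | ascending c => {p | p.1 - p.2 = c}
  | descending c => {p | p.1 + p.2 = c}

/-- The orthogonal reflection across a diagonal, on lattice points. -/
def reflect : GridDiagonal → ℤ × ℤ → ℤ × ℤ
  | ascending c, p => (p.2 + c, p.1 - c)
  | descending c, p => (c - p.2, c - p.1)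

end GridDiagonal

/-- A subgraph of the grid is symmetric about `d` if the reflection across `d` preserves its
vertex set and its edge set. -/
def SymmetricAbout (G : gridGraph.Subgraph) (d : GridDiagonal) : Prop :=
  (∀ p, d.reflect p ∈ G.verts ↔ p ∈ G.verts) ∧
    ∀ p q, G.Adj (d.reflect p) (d.reflect q) ↔ G.Adj p q

/-- A lattice point as a point of the plane. -/
def toPlane (p : ℤ × ℤ) : ℝ × ℝ := ((p.1 : ℝ), (p.2 : ℝ))

/-- The plane drawing of a subgraph of the grid: its vertices, and the closed unit segments that
represent its edges. -/
def drawing (G : gridGraph.Subgraph) : Set (ℝ × ℝ) :=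
  toPlane '' G.verts ∪ {x | ∃ p q, G.Adj p q ∧ x ∈ segment ℝ (toPlane p) (toPlane q)}

/-- The unbounded face: the points of the complement of the drawing whose connected component in
that complement is unbounded. -/
def unboundedFace (G : gridGraph.Subgraph) : Set (ℝ × ℝ) :=
  {x | x ∈ (drawing G)ᶜ ∧ ¬ Bornology.IsBounded (connectedComponentIn (drawing G)ᶜ x)}

/-- A vertex is on the unbounded face if it lies on the boundary of that face. -/
def OnUnboundedFace (G : gridGraph.Subgraph) (v : G.verts) : Prop :=
  toPlane v.1 ∈ frontier (unboundedFace G)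

/-- The spanning trees of `G`: trees on the full vertex set of `G` all of whose edges are edges
of `G`. -/
def GridSpanningTree (G : gridGraph.Subgraph) : Type :=
  {T : SimpleGraph G.verts // T ≤ G.coe ∧ T.IsTree}

/-- Every set of spanning trees is an event. -/
instance (G : gridGraph.Subgraph) : MeasurableSpace (GridSpanningTree G) := ⊤

/-- `T.Exits v u w`: when the edges of `T` are oriented toward the root `v`, the edge from `u` to
`w` is an edge of `T` that points out of `u`, i.e. the path of `T` from `u` to `v` starts with
the step from `u` to `w`. -/
def GridSpanningTree.Exits {G : gridGraph.Subgraph} (T : GridSpanningTree G)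
    (v u w : G.verts) : Prop :=
  ∃ (h : T.1.Adj u w) (p : T.1.Walk w v), (SimpleGraph.Walk.cons h p).IsPath

/-- In the tree `T` rooted at `v`, the vertex `u` is exited along a horizontal edge. -/
def GridSpanningTree.ExitsHorizontally {G : gridGraph.Subgraph} (T : GridSpanningTree G)
    (v u : G.verts) : Prop :=
  ∃ w : G.verts, T.Exits v u w ∧ w.1.2 = u.1.2

/-- The indicator random variable of the event that `u` is exited along a horizontal edge in the
spanning tree rooted at `v`. -/
def horizontalExit {G : gridGraph.Subgraph} (v u : G.verts) : GridSpanningTree G → ℝ :=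
  Set.indicator {T | T.ExitsHorizontally v u} (fun _ => 1)

/-- The law of a spanning tree of `G` chosen uniformly at random. -/
def uniformSpanningTree (G : gridGraph.Subgraph) : Measure (GridSpanningTree G) :=
  uniformOn Set.univ

end

/-!
The argument is algebraic and concerns an arbitrary finite graph with an involutive automorphism
`σ` that fixes the root `r`, together with a relation `H` on directed edges such that `σ` exchanges,
at each fixed vertex, the edges satisfying `H` with the remaining ones. For the grid, `σ` is the
reflection across the diagonal, and it exchanges the horizontal and the vertical edges at each
vertex of the diagonal.

By the matrix-tree theorem for rooted trees (`det_groundedLaplacian_eq_sum_trees`), the determinant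
of the Laplacian grounded at `r`, built from directed weights `c u w`, is the sum over spanning
trees of the product of `c u (parent u)` over the vertices `u ≠ r`. It is proved by expanding the
determinant along rows: the terms are indexed by functions `f`, and the term of `f` has determinant
`1` if iterating `f` leads every vertex to the root, and `0` otherwise.

Now let `s` be a set of `k` fixed vertices other than the root, and give weight `2` to the edges
out of `s` that satisfy `H` and weight `0` to the other edges out of `s`. The sum becomes `2 ^ k`
times the number of spanning trees in which every vertex of `s` is exited along `H`. On the other
hand the change of weights only alters the rows of `s`, by functionals that are antisymmetric under
`σ`. Split functions into symmetric and antisymmetric ones. The original Laplacian is block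
diagonal, while the perturbation contributes only to the block from antisymmetric to symmetric
functions, so the determinant does not change (`Matrix.det_add_eq_of_involutive`). Hence a
proportion `2⁻¹ ^ k` of the spanning trees exits every vertex of `s` along `H`
(`two_pow_mul_ncard_forall_parent`), which for all `s` together says that these events are
independent and have probability `1 / 2`.
-/

/-! ### Parent maps -/

section ParentMap

variable {V : Type*}

/-- `f` is the parent map of a tree on `V` rooted at `r`: iterating `f` leads every vertex to `r`.
The root is encoded as its own parent. -/
def IsParentMap (r : V) (f : V → V) : Prop :=
  f r = r ∧ ∀ u, ∃ k, f^[k] u = r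

theorem IsParentMap.exists_depth {r : V} {f : V → V} (hf : IsParentMap r f) :
    ∃ b : V → ℕ, ∀ u, u ≠ r → b (f u) < b u := by
  classical
  refine ⟨fun u => Nat.find (hf.2 u), fun u hu => ?_⟩
  have hspec := Nat.find_spec (hf.2 u)
  obtain ⟨k, hk⟩ : ∃ k, Nat.find (hf.2 u) = k + 1 := by
    refine Nat.exists_eq_succ_of_ne_zero fun h0 => hu ?_
    rw [h0] at hspec
    exact hspec
  rw [hk, Function.iterate_succ_apply] at hspec
  have := Nat.find_min' (hf.2 (f u)) hspec
  dsimp only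
  omega

theorem isParentMap_of_depth {r : V} {f : V → V} (hr : f r = r) (b : V → ℕ)
    (hb : ∀ u, u ≠ r → b (f u) < b u) : IsParentMap r f := by
  refine ⟨hr, fun u => ?_⟩
  induction h : b u using Nat.strong_induction_on generalizing u with
  | _ n ih =>
    by_cases hu : u = r
    · exact ⟨0, hu⟩
    · obtain ⟨k, hk⟩ := ih _ (h ▸ hb u hu) (f u) rfl
      exact ⟨k + 1, hk⟩

theorem IsParentMap.apply_ne {r : V} {f : V → V} (hf : IsParentMap r f) {u : V} (hu : u ≠ r) :
    f u ≠ u := by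
  obtain ⟨b, hb⟩ := hf.exists_depth
  intro h
  have := hb u hu
  rw [h] at this
  exact this.false

/-- The graph whose edges join each vertex to its image under `f`. -/
def parentGraph (f : V → V) : SimpleGraph V :=
  SimpleGraph.fromRel fun u w => f u = w

theorem parentGraph_adj {f : V → V} {u w : V} :
    (parentGraph f).Adj u w ↔ u ≠ w ∧ (f u = w ∨ f w = u) := by
  simp [parentGraph]

theorem IsParentMap.parentGraph_adj_apply {r : V} {f : V → V} (hf : IsParentMap r f) {u : V}
    (hu : u ≠ r) : (parentGraph f).Adj u (f u) :=
  parentGraph_adj.2 ⟨(hf.apply_ne hu).symm, Or.inl rfl⟩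

theorem IsParentMap.parentGraph_connected {r : V} {f : V → V} (hf : IsParentMap r f) :
    (parentGraph f).Connected := by
  have key : ∀ k u, f^[k] u = r → (parentGraph f).Reachable u r := by
    intro k
    induction k with
    | zero => rintro u rfl; exact SimpleGraph.Reachable.refl _
    | succ k ih =>
      intro u h
      by_cases hu : u = r
      · rw [hu]
      · exact (hf.parentGraph_adj_apply hu).reachable.trans (ih (f u) h)
  have : ∀ u, (parentGraph f).Reachable u r := fun u => (hf.2 u).elim fun k => key k u
  exact { preconnected := fun u w => (this u).trans (this w).symm, nonempty := ⟨r⟩ }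

theorem IsParentMap.parentGraph_isTree [Finite V] {r : V} {f : V → V} (hf : IsParentMap r f) :
    (parentGraph f).IsTree := by
  classical
  have := Fintype.ofFinite V
  rw [SimpleGraph.isTree_iff_connected_and_card]
  refine ⟨hf.parentGraph_connected,
    le_antisymm ?_ hf.parentGraph_connected.card_vert_le_card_edgeSet_add_one⟩
  -- Each edge is `s(u, f u)` for a vertex `u` other than the root.
  have hsub : (parentGraph f).edgeSet ⊆
      (((Finset.univ.erase r).image fun u => s(u, f u) : Finset (Sym2 V)) : Set (Sym2 V)) := by
    intro e
    induction e using Sym2.ind with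
    | _ a b =>
      intro h
      rw [SimpleGraph.mem_edgeSet, parentGraph_adj] at h
      obtain ⟨hab, rfl | rfl⟩ := h
      · have : a ≠ r := by rintro rfl; exact hab hf.1.symm
        simpa using ⟨a, this, Or.inl ⟨rfl, rfl⟩⟩
      · have : b ≠ r := by rintro rfl; exact hab hf.1
        simpa using ⟨b, this, by simp⟩
  have h1 : Nat.card (parentGraph f).edgeSet ≤ (Finset.univ.erase r).card :=
    (Nat.card_mono (Finset.finite_toSet _) hsub).trans (by
      rw [Nat.card_coe_set_eq, Set.ncard_coe_finset]
      exact Finset.card_image_le)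
  rw [Finset.card_erase_of_mem (Finset.mem_univ r), Finset.card_univ] at h1
  have : 0 < Fintype.card V := Fintype.card_pos_iff.2 ⟨r⟩
  rw [Nat.card_eq_fintype_card (α := V)]
  omega

end ParentMap

namespace SimpleGraph

variable {V : Type*} {T : SimpleGraph V} {r u w w' : V}

theorem IsTree.exists_adj_dist_lt (hT : T.IsTree) (hu : u ≠ r) :
    ∃ w, T.Adj u w ∧ T.dist w r < T.dist u r := by
  obtain ⟨p, hp⟩ := hT.connected.exists_walk_length_eq_dist u r
  cases p with
  | nil => exact absurd rfl hu
  | cons h q =>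
    refine ⟨_, h, ?_⟩
    rw [← hp, Walk.length_cons]
    exact Nat.lt_succ_of_le (dist_le q)

/-- A step along an edge of a tree begins the path to `r` exactly if it decreases the distance
to `r`. -/
theorem IsTree.exists_isPath_cons_iff (hT : T.IsTree) :
    (∃ (h : T.Adj u w) (p : T.Walk w r), (Walk.cons h p).IsPath) ↔
      T.Adj u w ∧ T.dist w r < T.dist u r := by
  constructor
  · rintro ⟨h, p, hp⟩
    refine ⟨h, ?_⟩
    obtain ⟨q, hq, hql⟩ := hT.connected.exists_path_of_dist u r
    have := (hT.existsUnique_path u r).unique hp hq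
    rw [← hql, ← this, Walk.length_cons]
    exact Nat.lt_succ_of_le (dist_le p)
  · rintro ⟨h, hd⟩
    obtain ⟨p, hp⟩ := hT.connected.exists_walk_length_eq_dist w r
    refine ⟨h, p, Walk.isPath_of_length_eq_dist _ (le_antisymm ?_ (dist_le _))⟩
    rw [Walk.length_cons, hp]
    exact hd

theorem IsTree.eq_of_adj_of_dist_lt (hT : T.IsTree) (h : T.Adj u w) (h' : T.Adj u w')
    (hd : T.dist w r < T.dist u r) (hd' : T.dist w' r < T.dist u r) : w = w' := by
  obtain ⟨_, p, hp⟩ := hT.exists_isPath_cons_iff.2 ⟨h, hd⟩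
  obtain ⟨_, q, hq⟩ := hT.exists_isPath_cons_iff.2 ⟨h', hd'⟩
  simpa using congrArg Walk.snd ((hT.existsUnique_path u r).unique hp hq)

open Classical in
/-- The neighbour of `u` closer to the root `r`. The root itself, which has no such neighbour, is
its own parent. -/
noncomputable def parent (T : SimpleGraph V) (r u : V) : V :=
  if h : ∃ w, T.Adj u w ∧ T.dist w r < T.dist u r then h.choose else u

theorem parent_self : T.parent r r = r := by
  simp [parent]

theorem IsTree.parent_spec (hT : T.IsTree) (hu : u ≠ r) :
    T.Adj u (T.parent r u) ∧ T.dist (T.parent r u) r < T.dist u r := by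
  have h := hT.exists_adj_dist_lt hu
  rw [parent, dif_pos h]
  exact h.choose_spec

theorem IsTree.parent_eq (hT : T.IsTree) (h : T.Adj u w) (hd : T.dist w r < T.dist u r) :
    T.parent r u = w := by
  have hu : u ≠ r := by rintro rfl; simp at hd
  have := hT.parent_spec hu
  exact hT.eq_of_adj_of_dist_lt this.1 h this.2 hd

theorem IsTree.isParentMap_parent (hT : T.IsTree) : IsParentMap r (T.parent r) :=
  isParentMap_of_depth parent_self (fun u => T.dist u r) fun _ hu => (hT.parent_spec hu).2

theorem IsTree.parentGraph_parent (hT : T.IsTree) : parentGraph (T.parent r) = T := by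
  ext a b
  rw [parentGraph_adj]
  constructor
  · rintro ⟨hab, rfl | rfl⟩
    · refine (hT.parent_spec ?_).1
      rintro rfl
      exact hab parent_self.symm
    · refine (hT.parent_spec ?_).1.symm
      rintro rfl
      exact hab parent_self
  · intro h
    refine ⟨h.ne, ?_⟩
    have hne := hT.dist_ne_of_adj r h
    rw [dist_comm (u := r) (v := a), dist_comm (u := r) (v := b)] at hne
    rcases lt_or_gt_of_ne hne with hlt | hlt
    · exact Or.inr (hT.parent_eq h.symm hlt)
    · exact Or.inl (hT.parent_eq h hlt)

theorem _root_.IsParentMap.parent_parentGraph [Finite V] {f : V → V} (hf : IsParentMap r f) :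
    (parentGraph f).parent r = f := by
  have hT := hf.parentGraph_isTree
  funext u
  induction h : (parentGraph f).dist u r using Nat.strong_induction_on generalizing u with
  | _ n ih =>
    by_cases hu : u = r
    · rw [hu, parent_self, hf.1]
    · obtain ⟨hadj, hlt⟩ := hT.parent_spec hu
      rcases (parentGraph_adj.1 hadj).2 with h1 | h1
      · exact h1.symm
      -- Otherwise `u` would be, by induction, the parent of a vertex closer to the root than `u`.
      · exfalso
        set w := (parentGraph f).parent r u with hw
        have hwr : w ≠ r := by
          intro hwr
          rw [hwr, hf.1] at h1
          exact hu h1.symm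
        have h2 := (hT.parent_spec hwr).2
        rw [ih _ (h ▸ hlt) w rfl, h1] at h2
        exact (hlt.trans h2).false

end SimpleGraph

/-! ### The weighted matrix-tree theorem for rooted trees -/

section MatrixTree

variable {V : Type*} [Fintype V] [DecidableEq V]

/-- The Laplacian of a directed weight function `c` grounded at `r`: row `u ≠ r` is
`∑ w, c u w • (e_u - e_w)`, and row `r` is replaced by `e_r`, which has the effect of deleting the
row and column of the root from the determinant. -/
noncomputable def groundedLaplacian (c : V → V → ℝ) (r : V) : Matrix V V ℝ := fun u =>
  if u = r then Pi.single r 1 else ∑ w, c u w • (Pi.single u 1 - Pi.single w 1)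

/-- The grounded Laplacian of the directed graph with the single edge `u → f u` out of each
`u ≠ r`. -/
noncomputable def functionalLaplacian (f : V → V) (r : V) : Matrix V V ℝ := fun u =>
  if u = r then Pi.single r 1 else Pi.single u 1 - Pi.single (f u) 1

theorem IsParentMap.det_functionalLaplacian {r : V} {f : V → V} (hf : IsParentMap r f) :
    (functionalLaplacian f r).det = 1 := by
  obtain ⟨b, hb⟩ := hf.exists_depth
  have hM : (functionalLaplacian f r).BlockTriangular fun u => OrderDual.toDual (b u) := by
    intro u w h
    have h : b u < b w := h
    have hwu : w ≠ u := by rintro rfl; exact h.false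
    by_cases hu : u = r
    · subst hu
      simp [functionalLaplacian, hwu]
    · have hwf : w ≠ f u := by rintro rfl; exact (h.trans (hb u hu)).false
      simp [functionalLaplacian, hu, hwu, hwf]
  rw [hM.det]
  refine Finset.prod_eq_one fun k _ => ?_
  have : (functionalLaplacian f r).toSquareBlock (fun u => OrderDual.toDual (b u)) k = 1 := by
    ext ⟨u, hu⟩ ⟨w, hw⟩
    have huw : b u = b w := congrArg OrderDual.ofDual (hu.trans hw.symm)
    by_cases hur : u = r
    · subst hur
      simp [Matrix.toSquareBlock_def, functionalLaplacian, Matrix.one_apply, Pi.single_apply,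
        eq_comm]
    · have hwf : w ≠ f u := by
        rintro rfl
        exact (huw ▸ hb u hur).false
      simp [Matrix.toSquareBlock_def, functionalLaplacian, Matrix.one_apply, Pi.single_apply, hwf,
        hur, eq_comm (a := w)]
  rw [this, Matrix.det_one]

/-- The indicator of the vertices that never reach the root lies in the kernel. -/
theorem det_functionalLaplacian_of_not_isParentMap {r : V} {f : V → V} (hr : f r = r)
    (hf : ¬ IsParentMap r f) : (functionalLaplacian f r).det = 0 := by
  classical
  have hf' : ∃ u, ∀ k, f^[k] u ≠ r := by
    by_contra! h
    exact hf ⟨hr, h⟩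
  obtain ⟨u₀, hu₀⟩ := hf'
  refine Matrix.exists_mulVec_eq_zero_iff.1
    ⟨fun u => if ∀ k, f^[k] u ≠ r then 1 else 0, ?_, ?_⟩
  · intro h
    have := congrFun h u₀
    simp [hu₀] at this
  · funext u
    by_cases hu : u = r
    · subst hu
      have : ∃ k, f^[k] u = u := ⟨0, rfl⟩
      simp [Matrix.mulVec, functionalLaplacian, this]
    · have : (∀ k, f^[k] u ≠ r) ↔ ∀ k, f^[k] (f u) ≠ r := by
        refine ⟨fun h k => h (k + 1), fun h k => ?_⟩
        cases k with
        | zero => exact hu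
        | succ k => exact h k
      have hrow : functionalLaplacian f r u = Pi.single u 1 - Pi.single (f u) 1 := if_neg hu
      rw [Matrix.mulVec, hrow, sub_dotProduct, single_one_dotProduct, single_one_dotProduct]
      simp only [this, sub_self, Pi.zero_apply]

open Classical in
theorem det_groundedLaplacian_eq_sum_maps (c : V → V → ℝ) (r : V) :
    (groundedLaplacian c r).det =
      ∑ f : V → V, if IsParentMap r f then ∏ u ∈ Finset.univ.erase r, c u (f u) else 0 := by
  have hrows : groundedLaplacian c r = fun u => ∑ w ∈ if u = r then {r} else Finset.univ,
      (if u = r then (1 : ℝ) else c u w) •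
        (if u = r then Pi.single r 1 else Pi.single u 1 - Pi.single w 1 : V → ℝ) := by
    funext u
    by_cases hu : u = r <;> simp [groundedLaplacian, hu]
  have h := Matrix.detRowAlternating.toMultilinearMap.map_sum_finset (R := ℝ)
    (fun u w => (if u = r then (1 : ℝ) else c u w) •
        (if u = r then Pi.single r 1 else Pi.single u 1 - Pi.single w 1 : V → ℝ))
    (fun u => if u = r then ({r} : Finset V) else Finset.univ)
  rw [← hrows] at h
  refine h.trans ?_
  rw [← Finset.sum_subset (Finset.subset_univ (Fintype.piFinset _))]
  · refine Finset.sum_congr rfl fun f hf => ?_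
    have hfr : f r = r := by simpa using Fintype.mem_piFinset.1 hf r
    rw [MultilinearMap.map_smul_univ]
    have hdet : Matrix.detRowAlternating.toMultilinearMap (fun u =>
        (if u = r then Pi.single r 1 else Pi.single u 1 - Pi.single (f u) 1 : V → ℝ)) =
        (functionalLaplacian f r).det := rfl
    rw [hdet]
    have hprod : (∏ u, if u = r then (1 : ℝ) else c u (f u)) =
        ∏ u ∈ Finset.univ.erase r, c u (f u) := by
      rw [← Finset.mul_prod_erase _ _ (Finset.mem_univ r), if_pos rfl, one_mul]
      exact Finset.prod_congr rfl fun u hu => if_neg (Finset.ne_of_mem_erase hu)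
    by_cases hp : IsParentMap r f
    · rw [if_pos hp, hp.det_functionalLaplacian, hprod, smul_eq_mul, mul_one]
    · rw [if_neg hp, det_functionalLaplacian_of_not_isParentMap hfr hp, smul_zero]
  · intro f _ hf
    refine if_neg fun hp => hf (Fintype.mem_piFinset.2 fun u => ?_)
    by_cases hu : u = r
    · subst hu
      simp [hp.1]
    · simp [hu]

/-- The weighted matrix-tree theorem: the grounded Laplacian enumerates spanning trees oriented
toward the root, each weighted by the product of the weights of its directed edges. -/
theorem det_groundedLaplacian_eq_sum_trees (G : SimpleGraph V) (r : V) (c : V → V → ℝ)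
    (hc : ∀ u w, u ≠ r → ¬ G.Adj u w → c u w = 0)
    [Fintype {T : SimpleGraph V // T ≤ G ∧ T.IsTree}] :
    (groundedLaplacian c r).det = ∑ T : {T : SimpleGraph V // T ≤ G ∧ T.IsTree},
      ∏ u ∈ Finset.univ.erase r, c u (T.1.parent r u) := by
  classical
  rw [det_groundedLaplacian_eq_sum_maps]
  symm
  refine Fintype.sum_of_injective (fun T => T.1.parent r) ?_ _ _ ?_ ?_
  · intro T T' h
    have h : T.1.parent r = T'.1.parent r := h
    refine Subtype.ext ?_
    rw [← T.2.2.parentGraph_parent (r := r), h, T'.2.2.parentGraph_parent]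
  · intro f hf
    split_ifs with hp
    · by_contra hne
      refine hf ⟨⟨parentGraph f, ?_, hp.parentGraph_isTree⟩, hp.parent_parentGraph⟩
      have hadj : ∀ u, u ≠ r → G.Adj u (f u) := by
        intro u hu
        by_contra hn
        exact hne (Finset.prod_eq_zero (Finset.mem_erase.2 ⟨hu, Finset.mem_univ u⟩)
          (hc u _ hu hn))
      intro a b hab
      obtain ⟨hab, rfl | rfl⟩ := parentGraph_adj.1 hab
      · exact hadj a (by rintro rfl; exact hab hp.1.symm)
      · exact (hadj b (by rintro rfl; exact hab hp.1)).symm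
    · rfl
  · intro T
    rw [if_pos T.2.2.isParentMap_parent]

end MatrixTree

/-! ### Reflections -/

section Reflection

variable {V : Type*} [Fintype V] [DecidableEq V]

/-- With respect to the decomposition into functions that are symmetric and antisymmetric under
`σ`, the matrix `A` is block diagonal, and `K` maps antisymmetric functions to symmetric ones and
kills the latter. So `A + K` is block triangular with the diagonal blocks of `A`. -/
theorem Matrix.det_add_eq_of_involutive {σ : V → V} (hσ : Function.Involutive σ)
    {A K : Matrix V V ℝ} (hA : ∀ u w, A (σ u) (σ w) = A u w)
    (hK : ∀ u w, σ u ≠ u → K u w = 0) (hK' : ∀ u w, K u (σ w) = -K u w) :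
    (A + K).det = A.det := by
  set Q : Matrix V V ℝ := Matrix.of fun u w => if σ u = w then 1 else 0 with hQ
  have hQmul : ∀ (M : Matrix V V ℝ) u w, (Q * M) u w = M (σ u) w := by
    intro M u w
    simp [hQ, Matrix.mul_apply]
  have hmulQ : ∀ (M : Matrix V V ℝ) u w, (M * Q) u w = M u (σ w) := by
    intro M u w
    have : ∀ x, σ x = w ↔ x = σ w := fun x => hσ.eq_iff
    simp [hQ, Matrix.mul_apply, this]
  have hQQ : Q * Q = 1 := by
    ext u w
    rw [hQmul]
    simp [hQ, hσ u, Matrix.one_apply]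
  have hAQ : A * Q = Q * A := by
    ext u w
    rw [hQmul, hmulQ, ← hA, hσ w]
  have hQK : Q * K = K := by
    ext u w
    rw [hQmul]
    by_cases hu : σ u = u
    · rw [hu]
    · rw [hK u w hu, hK (σ u) w (by rwa [hσ u, ne_comm])]
  have hKQ : K * Q = -K := by
    ext u w
    rw [hmulQ, hK', Matrix.neg_apply]
  -- Conjugating by `D t`, which is `2` on symmetric and `2 * t` on antisymmetric functions,
  -- multiplies `K` by `t` and fixes `A`; then `t` is sent to `0`.
  set D : ℝ → Matrix V V ℝ := fun t => (1 + Q) + t • (1 - Q) with hD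
  have hDD : ∀ t : ℝ, t ≠ 0 → D t * D t⁻¹ = (4 : ℝ) • 1 := by
    intro t ht
    simp only [hD, mul_add, add_mul, mul_sub, sub_mul, Matrix.smul_mul, Matrix.mul_smul, mul_one,
      one_mul, hQQ]
    match_scalars <;> field_simp <;> ring
  have hconj : ∀ t, (A + K) * D t = D t * (A + t • K) := by
    intro t
    simp only [hD, mul_add, add_mul, mul_sub, sub_mul, Matrix.smul_mul, Matrix.mul_smul, mul_one,
      one_mul, hAQ, hQK, hKQ]
    module
  have hdet : ∀ t : ℝ, t ≠ 0 → (A + t • K).det = (A + K).det := by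
    intro t ht
    have hne : (D t).det ≠ 0 := by
      intro h0
      have := congrArg Matrix.det (hDD t ht)
      rw [Matrix.det_mul, h0, zero_mul, Matrix.det_smul, Matrix.det_one, mul_one] at this
      exact pow_ne_zero _ (by norm_num) this.symm
    have := congrArg Matrix.det (hconj t)
    rw [Matrix.det_mul, Matrix.det_mul, mul_comm] at this
    exact (mul_left_cancel₀ hne this).symm
  have hcont : Continuous fun t : ℝ => (A + t • K).det := by fun_prop
  have := congrFun (hcont.ext_on (dense_compl_singleton (0 : ℝ)) continuous_const
    (fun t ht => hdet t ht)) 0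
  simpa using this.symm

theorem groundedLaplacian_apply_root (c : V → V → ℝ) (r w : V) :
    groundedLaplacian c r r w = if w = r then 1 else 0 := by
  simp [groundedLaplacian, Pi.single_apply]

theorem groundedLaplacian_apply_of_ne (c : V → V → ℝ) {r u : V} (hu : u ≠ r) (w : V) :
    groundedLaplacian c r u w = (if w = u then ∑ x, c u x else 0) - c u w := by
  simp only [groundedLaplacian, if_neg hu, Finset.sum_apply, Pi.smul_apply, Pi.sub_apply,
    Pi.single_apply, smul_eq_mul, mul_sub, mul_ite, mul_one, mul_zero, Finset.sum_sub_distrib]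
  by_cases hw : w = u <;> simp [hw]

/-- The weights that force the vertices of `s` to be left along edges satisfying `H`, with weight
`2` to compensate for the excluded half of the edges. -/
noncomputable def forcedWeight (G : SimpleGraph V) (H : V → V → Prop) (s : Finset V) (u w : V) :
    ℝ :=
  open Classical in
  if G.Adj u w then if u ∈ s then if H u w then 2 else 0 else 1 else 0

/-- If the reflection `σ` exchanges, at each vertex of the mirror, the edges satisfying `H` with
the others, then forcing exits along `H` does not change the weighted number of rooted trees. -/
theorem det_groundedLaplacian_forcedWeight (G : SimpleGraph V) {σ : V → V}
    (hσ : Function.Involutive σ) (hadj : ∀ u w, G.Adj (σ u) (σ w) ↔ G.Adj u w) {r : V}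
    (hr : σ r = r) {H : V → V → Prop}
    (hH : ∀ u w, σ u = u → G.Adj u w → (H u (σ w) ↔ ¬ H u w)) {s : Finset V}
    (hs : ∀ u ∈ s, σ u = u ∧ u ≠ r) :
    (groundedLaplacian (forcedWeight G H s) r).det =
      (groundedLaplacian (forcedWeight G H ∅) r).det := by
  set a : V → V → ℝ := fun u w => forcedWeight G H s u w - forcedWeight G H ∅ u w with ha
  have ha0 : ∀ u w, u ∉ s → a u w = 0 := by
    intro u w hu
    simp [ha, forcedWeight, hu]
  have haσ : ∀ u w, a u (σ w) = -a u w := by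
    intro u w
    by_cases hu : u ∈ s
    · have hfix := (hs u hu).1
      have h1 : G.Adj u (σ w) ↔ G.Adj u w := by
        have := hadj u w
        rwa [hfix] at this
      by_cases hw : G.Adj u w
      · have h2 := hH u w hfix hw
        by_cases h3 : H u w <;> simp [ha, forcedWeight, hu, h1, hw, h2, h3] <;> norm_num
      · simp [ha, forcedWeight, h1, hw]
    · rw [ha0 u _ hu, ha0 u _ hu, neg_zero]
  have hsum : ∀ u, ∑ x, forcedWeight G H s u x = ∑ x, forcedWeight G H ∅ u x := by
    intro u
    have h1 : ∑ x, a u (σ x) = ∑ x, a u x := Equiv.sum_comp hσ.toPerm (a u)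
    simp only [haσ, Finset.sum_neg_distrib] at h1
    have h2 : ∑ x, a u x = 0 := by linarith
    rwa [ha, Finset.sum_sub_distrib, sub_eq_zero] at h2
  have hdecomp : groundedLaplacian (forcedWeight G H s) r =
      groundedLaplacian (forcedWeight G H ∅) r + Matrix.of fun u w => -a u w := by
    ext u w
    rw [Matrix.add_apply, Matrix.of_apply]
    by_cases hu : u = r
    · have : r ∉ s := fun h => (hs r h).2 rfl
      rw [hu, groundedLaplacian_apply_root, groundedLaplacian_apply_root, ha0 r w this, neg_zero,
        add_zero]
    · rw [groundedLaplacian_apply_of_ne _ hu, groundedLaplacian_apply_of_ne _ hu, hsum]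
      simp only [ha]
      ring
  rw [hdecomp]
  have hc : ∀ u w, forcedWeight G H ∅ (σ u) (σ w) = forcedWeight G H ∅ u w := by
    intro u w
    by_cases h : G.Adj u w <;> simp [forcedWeight, hadj, h]
  refine Matrix.det_add_eq_of_involutive hσ ?_ ?_ ?_
  · intro u w
    by_cases hu : u = r
    · have : σ w = r ↔ w = r := by rw [hσ.eq_iff, hr]
      rw [hu, hr, groundedLaplacian_apply_root, groundedLaplacian_apply_root]
      simp only [this]
    · have hu' : σ u ≠ r := by rwa [Ne, hσ.eq_iff, hr]
      rw [groundedLaplacian_apply_of_ne _ hu, groundedLaplacian_apply_of_ne _ hu', hc,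
        ← Equiv.sum_comp hσ.toPerm]
      simp only [Function.Involutive.coe_toPerm, hc, hσ.injective.eq_iff]
  · intro u w hu
    have : u ∉ s := fun h => hu (hs u h).1
    simp [ha0 u w this]
  · intro u w
    simp [haσ u w]

/-- Forcing the exits at `k` vertices of the mirror divides the number of spanning trees by
`2 ^ k`. -/
theorem two_pow_mul_ncard_forall_parent (G : SimpleGraph V) {σ : V → V}
    (hσ : Function.Involutive σ) (hadj : ∀ u w, G.Adj (σ u) (σ w) ↔ G.Adj u w) {r : V}
    (hr : σ r = r) {H : V → V → Prop}
    (hH : ∀ u w, σ u = u → G.Adj u w → (H u (σ w) ↔ ¬ H u w)) {s : Finset V}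
    (hs : ∀ u ∈ s, σ u = u ∧ u ≠ r) [Fintype {T : SimpleGraph V // T ≤ G ∧ T.IsTree}] :
    2 ^ s.card * {T : {T : SimpleGraph V // T ≤ G ∧ T.IsTree} |
      ∀ u ∈ s, H u (T.1.parent r u)}.ncard =
        Fintype.card {T : SimpleGraph V // T ≤ G ∧ T.IsTree} := by
  classical
  have key : ∀ t : Finset V, (∀ u ∈ t, u ≠ r) →
      (groundedLaplacian (forcedWeight G H t) r).det =
        2 ^ t.card * (Finset.univ.filter fun T : {T : SimpleGraph V // T ≤ G ∧ T.IsTree} =>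
          ∀ u ∈ t, H u (T.1.parent r u)).card := by
    intro t ht
    rw [det_groundedLaplacian_eq_sum_trees G r (forcedWeight G H t) fun u w _ h => if_neg h]
    have hterm : ∀ T : {T : SimpleGraph V // T ≤ G ∧ T.IsTree},
        ∏ u ∈ Finset.univ.erase r, forcedWeight G H t u (T.1.parent r u) =
          if ∀ u ∈ t, H u (T.1.parent r u) then 2 ^ t.card else 0 := by
      intro T
      have h1 : ∀ u ∈ Finset.univ.erase r, forcedWeight G H t u (T.1.parent r u) =
          if u ∈ t then (if H u (T.1.parent r u) then 2 else 0) else 1 := fun u hu =>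
        if_pos (T.2.1 (T.2.2.parent_spec (Finset.ne_of_mem_erase hu)).1)
      have h2 : Finset.univ.erase r ∩ t = t :=
        Finset.inter_eq_right.2 fun u hu => Finset.mem_erase.2 ⟨ht u hu, Finset.mem_univ u⟩
      rw [Finset.prod_congr rfl h1, Finset.prod_ite_mem, h2, Finset.prod_ite_zero,
        Finset.prod_const]
      congr
    rw [Finset.sum_congr rfl fun T _ => hterm T, ← Finset.sum_filter, Finset.sum_const,
      nsmul_eq_mul, mul_comm]
  have h := det_groundedLaplacian_forcedWeight G hσ hadj hr hH hs
  rw [key s fun u hu => (hs u hu).2, key ∅ (by simp)] at h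
  simp only [Finset.card_empty, pow_zero, one_mul, Finset.notMem_empty, false_imp_iff,
    implies_true, Finset.filter_true, Finset.card_univ] at h
  rw [← Finset.coe_filter_univ, Set.ncard_coe_finset]
  exact_mod_cast h

end Reflection

/-! ### Symmetric subgraphs of the grid -/

namespace GridDiagonal

theorem reflect_involutive (d : GridDiagonal) : Function.Involutive d.reflect := by
  rintro ⟨x, y⟩
  cases d <;> simp [reflect]

theorem reflect_eq_self_iff (d : GridDiagonal) (p : ℤ × ℤ) : d.reflect p = p ↔ p ∈ d.points := by
  obtain ⟨x, y⟩ := p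
  cases d <;> simp only [reflect, points, Prod.mk.injEq, Set.mem_ofPred_eq] <;> omega

theorem reflect_snd_eq_iff (d : GridDiagonal) {p q : ℤ × ℤ} (hp : p ∈ d.points)
    (h : gridGraph.Adj p q) : (d.reflect q).2 = p.2 ↔ ¬ q.2 = p.2 := by
  obtain ⟨x, y⟩ := p
  obtain ⟨x', y'⟩ := q
  have h : (y = y' ∧ |x - x'| = 1) ∨ (x = x' ∧ |y - y'| = 1) := h
  cases d <;> simp only [reflect, points, Set.mem_ofPred_eq] at hp ⊢ <;>
    rcases h with ⟨h1, h2⟩ | ⟨h1, h2⟩ <;>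
    rcases abs_eq (zero_le_one' ℤ) |>.1 h2 with h3 | h3 <;> omega

end GridDiagonal

theorem GridSpanningTree.exitsHorizontally_iff {G : gridGraph.Subgraph} (T : GridSpanningTree G)
    {v u : G.verts} (hu : u ≠ v) :
    T.ExitsHorizontally v u ↔ (T.1.parent v u).1.2 = u.1.2 := by
  have hT := T.2.2
  constructor
  · rintro ⟨w, hw, h⟩
    obtain ⟨hadj, hlt⟩ := hT.exists_isPath_cons_iff.1 hw
    rwa [hT.parent_eq hadj hlt]
  · intro h
    exact ⟨_, hT.exists_isPath_cons_iff.2 (hT.parent_spec hu), h⟩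

theorem uniformSpanningTree_forall_exitsHorizontally (G : gridGraph.Subgraph)
    (hfin : G.verts.Finite) (hconn : G.Connected) (d : GridDiagonal) (hsymm : SymmetricAbout G d)
    (v : G.verts) (hvd : v.1 ∈ d.points) (s : Finset G.verts)
    (hs : ∀ u ∈ s, u.1 ∈ d.points ∧ u ≠ v) :
    uniformSpanningTree G {T | ∀ u ∈ s, T.ExitsHorizontally v u} = 2⁻¹ ^ s.card := by
  have : Fintype G.verts := hfin.fintype
  classical
  let instTrees : Fintype {T : SimpleGraph G.verts // T ≤ G.coe ∧ T.IsTree} := Fintype.ofFinite _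
  let instGrid : Fintype (GridSpanningTree G) := instTrees
  have : Nonempty (GridSpanningTree G) := by
    obtain ⟨T, hT⟩ := hconn.coe.exists_isTree_le
    exact ⟨⟨T, hT⟩⟩
  let σ : G.verts → G.verts := fun p => ⟨d.reflect p.1, (hsymm.1 p.1).2 p.2⟩
  have hfix : ∀ u, σ u = u ↔ u.1 ∈ d.points := fun u => by
    rw [← d.reflect_eq_self_iff, Subtype.ext_iff]
  have hcard : 2 ^ s.card * {T : GridSpanningTree G | ∀ u ∈ s, T.ExitsHorizontally v u}.ncard =
      Fintype.card (GridSpanningTree G) := by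
    have hset : {T : GridSpanningTree G | ∀ u ∈ s, T.ExitsHorizontally v u} =
        {T | ∀ u ∈ s, (T.1.parent v u).1.2 = u.1.2} := by
      ext T
      exact forall₂_congr fun u hu => T.exitsHorizontally_iff (hs u hu).2
    rw [hset]
    exact two_pow_mul_ncard_forall_parent G.coe (σ := σ)
      (fun p => Subtype.ext (d.reflect_involutive p.1)) (fun p q => hsymm.2 p.1 q.1)
      ((hfix v).2 hvd) (H := fun u w => w.1.2 = u.1.2)
      (fun u w hu h => d.reflect_snd_eq_iff ((hfix u).1 hu) (G.adj_sub h)) (s := s)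
      (fun u hu => ⟨(hfix u).2 (hs u hu).1, (hs u hu).2⟩)
  have hne : {T : GridSpanningTree G | ∀ u ∈ s, T.ExitsHorizontally v u}.ncard ≠ 0 := by
    intro h0
    rw [h0, mul_zero] at hcard
    exact Fintype.card_ne_zero hcard.symm
  rw [uniformSpanningTree, uniformOn_univ, ← hcard, Measure.count_apply MeasurableSet.of_discrete,
    ← (Set.toFinite _).cast_ncard_eq]
  generalize {T : GridSpanningTree G | ∀ u ∈ s, T.ExitsHorizontally v u}.ncard = m at hne
  push_cast
  rw [ENNReal.div_eq_inv_mul, ENNReal.mul_inv (by simp) (by simp), mul_assoc,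
    ENNReal.inv_mul_cancel (by exact_mod_cast hne) (ENNReal.natCast_ne_top m), mul_one,
    ENNReal.inv_pow]

theorem hasLaw_indicator_bernoulliMeasure {Ω : Type*} [MeasurableSpace Ω] {μ : Measure Ω}
    [IsProbabilityMeasure μ] {A : Set Ω} (hA : MeasurableSet A) {p : unitInterval}
    (hp : μ A = unitInterval.toNNReal p) :
    HasLaw (A.indicator fun _ => (1 : ℝ)) (bernoulliMeasure 1 0 p) μ where
  aemeasurable := (measurable_const.indicator hA).aemeasurable
  map_eq := by
    classical
    have hadd : (unitInterval.toNNReal p : ENNReal) + unitInterval.toNNReal (unitInterval.symm p)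
        = 1 := by
      rw [← ENNReal.coe_add]
      simp
    have hcompl : μ Aᶜ = unitInterval.toNNReal (unitInterval.symm p) := by
      rw [prob_compl_eq_one_sub hA, hp, ← hadd, ENNReal.add_sub_cancel_left ENNReal.coe_ne_top]
    ext B hB
    rw [Measure.map_apply (measurable_const.indicator hA) hB, bernoulliMeasure_apply p hB,
      Set.indicator_const_preimage_eq_union]
    by_cases h1 : (1 : ℝ) ∈ B <;> by_cases h0 : (0 : ℝ) ∈ B <;> simp [h1, h0, hp, hcompl]

theorem corollary6p5 (G : gridGraph.Subgraph) (hfin : G.verts.Finite) (hconn : G.Connected)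
    (d : GridDiagonal) (hsymm : SymmetricAbout G d)
    (v : G.verts) (hvd : v.1 ∈ d.points) (hvout : OnUnboundedFace G v) :
    iIndepFun (fun (u : {u : G.verts // u.1 ∈ d.points ∧ u ≠ v}) => horizontalExit v u.1)
        (uniformSpanningTree G) ∧
      ∀ u : {u : G.verts // u.1 ∈ d.points ∧ u ≠ v},
        HasLaw (horizontalExit v u.1)
          (bernoulliMeasure (1 : ℝ) 0 ⟨1 / 2, by norm_num, by norm_num⟩)
          (uniformSpanningTree G) := by
  set A : {u : G.verts // u.1 ∈ d.points ∧ u ≠ v} → Set (GridSpanningTree G) :=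
    fun u => {T | T.ExitsHorizontally v u.1} with hA
  have hinter : ∀ S : Finset {u : G.verts // u.1 ∈ d.points ∧ u ≠ v},
      uniformSpanningTree G (⋂ u ∈ S, A u) = 2⁻¹ ^ S.card := by
    intro S
    have h := uniformSpanningTree_forall_exitsHorizontally G hfin hconn d hsymm v hvd
      (S.map (Function.Embedding.subtype _)) (by
        intro u hu
        obtain ⟨w, -, rfl⟩ := Finset.mem_map.1 hu
        exact w.2)
    rw [Finset.card_map] at h
    rw [← h]
    congr 1
    ext T
    simp [hA]
  have hsingle : ∀ u, uniformSpanningTree G (A u) = 2⁻¹ := fun u => by simpa using hinter {u}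
  have : IsProbabilityMeasure (uniformSpanningTree G) := ⟨by simpa using hinter ∅⟩
  refine ⟨iIndepSet.iIndepFun_indicator ?_, fun u => hasLaw_indicator_bernoulliMeasure
    MeasurableSet.of_discrete ?_⟩
  · refine (iIndepSet_iff_meas_biInter fun _ => MeasurableSet.of_discrete).2 fun S => ?_
    rw [hinter, Finset.prod_congr rfl fun u _ => hsingle u, Finset.prod_const]
  · refine (hsingle u).trans ?_
    rw [show unitInterval.toNNReal _ = 2⁻¹ by ext; simp]
    simp
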